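/- Let $-1<\rho<1$, $\theta\in\mathbb{R}$, $R=\begin{pmatrix}1&\rho\\ \rho&1\end{pmatrix}$, and let $\mathbf X=(X_1,X_2)^T$ have the bivariate skew normal distribution $SN_2(\boldsymbol\theta,R)$ with equal skewness $\boldsymbol\theta=(\theta,\theta)^T$; that is, $\mathbf X$ has density $f(\mathbf x)=2\,\phi_2(\mathbf x,R)\,\Phi(\theta x_1+\theta x_2)$ on $\mathbb{R}^2$, where $\phi_2(\cdot,R)$ is the density of the bivariate normal distribution with mean $\mathbf 0$ and correlation matrix $R$, and $\Phi$ is the standard normal cdf. Let $F_i$ be the cdf of $X_i$, $F_i^{-1}(u)=\inf\{x: F_i(x)\ge u\}$ its quantile function, $C(u_1,u_2)=P(X_1\le F_1^{-1}(u_1),X_2\le F_2^{-1}(u_2))$ the copula of $\mathbf X$, and $$\lambda_L(u)=P\bigl(X_1\le F_1^{-1}(u)\,\big|\,X_2\le F_2^{-1}(u)\bigr)=\frac{C(u,u)}{u},\qquad 0<u<1,$$ the lower tail dependence function. Put $$\lambda=\frac{\theta(1+\rho)}{\sqrt{1+\theta^2(1-\rho^2)}},\qquad \alpha=\frac{\theta(1+\rho)}{\sqrt{1+2\theta^2(1+\rho)}},\qquad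 \beta=\sqrt{\frac{(1-\rho)(1+2\theta^2(1+\rho))}{1+\rho}}.$$ Then, as $u\to0^+$ (where $f\sim g$ means $f/g\to1$): (a) if $\theta>0$, $$\lambda_L(u)\sim u^{\beta^2}\,\frac{\alpha^3}{\pi\lambda^4\beta(1+\beta^2)^2}\sqrt{\frac{2}{\pi}}\,(2\pi\lambda)^{1+\beta^2}\left(\frac{1+\lambda^2}{2}\right)^{3/2}(-\log u)^{\beta^2-\frac12};$$ (b) if $\theta<0$, $$\lambda_L(u)\sim u^{\frac{1-\rho}{1+\rho}}\cdot\frac{1+\rho}{2}\sqrt{\frac{1+\rho}{1-\rho}}\,(-\pi\log u)^{-\frac{\rho}{1+\rho}}.$$ -/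

import Mathlib

open MeasureTheory ProbabilityTheory Filter Asymptotics
open scoped Topology Matrix

noncomputable section

namespace SkewNormal

/-- The correlation matrix with off-diagonal entry `ρ`. -/
def corrMatrix (ρ : ℝ) : Matrix (Fin 2) (Fin 2) ℝ := !![1, ρ; ρ, 1]

/-- The Lebesgue density `φ₂(x, R)` of the centred bivariate normal distribution with
covariance matrix `R`. -/
def normalPDF₂ (R : Matrix (Fin 2) (Fin 2) ℝ) (x : Fin 2 → ℝ) : ℝ :=
  (2 * Real.pi * √R.det)⁻¹ * Real.exp (-(x ⬝ᵥ (R⁻¹ *ᵥ x)) / 2)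

/-- The cdf `Φ` of the univariate standard normal distribution. -/
def stdNormalCDF (z : ℝ) : ℝ := cdf (gaussianReal 0 1) z

/-- The density `2 φ₂(x, R) Φ(θᵀ x)`. -/
def skewNormalPDF₂ (θ : Fin 2 → ℝ) (R : Matrix (Fin 2) (Fin 2) ℝ) (x : Fin 2 → ℝ) : ℝ :=
  2 * normalPDF₂ R x * stdNormalCDF (θ ⬝ᵥ x)

/-- The bivariate skew normal distribution `SN₂(θ, R)`. -/
def skewNormal₂ (θ : Fin 2 → ℝ) (R : Matrix (Fin 2) (Fin 2) ℝ) : Measure (Fin 2 → ℝ) :=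
  volume.withDensity fun x => ENNReal.ofReal (skewNormalPDF₂ θ R x)

section TailDependence

variable {Ω : Type*} [MeasurableSpace Ω]

/-- The distribution function `F_i` of the `i`-th component of `X`. -/
def marginalCDF (P : Measure Ω) (X : Ω → Fin 2 → ℝ) (i : Fin 2) (x : ℝ) : ℝ :=
  P.real {ω | X ω i ≤ x}

/-- The quantile function `F_i⁻¹(u) = inf {x : F_i(x) ≥ u}`, for `0 < u < 1`. -/
def quantile (P : Measure Ω) (X : Ω → Fin 2 → ℝ) (i : Fin 2) (u : ℝ) : ℝ :=
  sInf {x : ℝ | u ≤ marginalCDF P X i x}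

/-- The copula `C(u₁, u₂) = P(X₁ ≤ F₁⁻¹(u₁), X₂ ≤ F₂⁻¹(u₂))` of `X`, for `0 < u₁, u₂ < 1`. -/
def copula (P : Measure Ω) (X : Ω → Fin 2 → ℝ) (u₁ u₂ : ℝ) : ℝ :=
  P.real {ω | X ω 0 ≤ quantile P X 0 u₁ ∧ X ω 1 ≤ quantile P X 1 u₂}

/-- The lower tail dependence function
`λ_L(u) = P(X₁ ≤ F₁⁻¹(u) | X₂ ≤ F₂⁻¹(u))`, for `0 < u < 1`. -/
def lowerTailDependence (P : Measure Ω) (X : Ω → Fin 2 → ℝ) (u : ℝ) : ℝ :=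
  (P[|{ω | X ω 1 ≤ quantile P X 1 u}]).real {ω | X ω 0 ≤ quantile P X 0 u}

end TailDependence

/-- The constant `λ`. -/
def lam (θ ρ : ℝ) : ℝ := θ * (1 + ρ) / √(1 + θ ^ 2 * (1 - ρ ^ 2))

/-- The constant `α`. -/
def alpha (θ ρ : ℝ) : ℝ := θ * (1 + ρ) / √(1 + 2 * θ ^ 2 * (1 + ρ))

/-- The constant `β`. -/
def beta (θ ρ : ℝ) : ℝ := √((1 - ρ) * (1 + 2 * θ ^ 2 * (1 + ρ)) / (1 + ρ))

end SkewNormal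

end

/-! Both tails are of Gaussian type, and eliminating the threshold between them gives the expansion.
Put `t = -F⁻¹(u)`; the two marginals coincide, so `λ_L(u) = G t / U t` with `U t = F(-t) = u` and `G
t = P(X₁ ≤ -t, X₂ ≤ -t)`.

Integrating out one coordinate leaves the univariate skew normal density `2 φ(x) Φ(λ x)`, because
averaging `Φ` of an affine function over a Gaussian gives `Φ` again (`lintegral_stdNormalCDF`,
`lintegral_skewNormalPDF₂`).

The substitution `y = -(t e + x / t)` turns a Gaussian weight into its value at the corner, times an
exponential in `x`, times a factor tending to `1`. Dominated convergence then gives both tails. The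
factor `Φ` contributes a Mills tail if `θ > 0` and tends to `1` if `θ < 0`; `IsTailScale` treats
both cases at once.

Hence `U t ~ c₁ t^(-p) exp(-a t²)` and `G t ~ c₂ t^(-q) exp(-b t²)`. The power `U^(b/a)` absorbs the
exponential in `G`, and `t² ~ -log u / a` replaces the remaining powers of `t`
(`isEquivalent_of_gaussian_tails`). For `θ > 0`, `b / a = 1 + β²`; for `θ < 0`, `b / a = 2 / (1 +
ρ)`. -/

namespace SkewNormal

/-! ### Laplace-type limits over orthants -/

section Rescaling

variable {E : Type*} [NormedAddCommGroup E] [NormedSpace ℝ E] [FiniteDimensional ℝ E]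
  [MeasurableSpace E] [BorelSpace E] [PartialOrder E] [IsOrderedAddMonoid E] [PosSMulMono ℝ E]
  [OrderClosedTopology E]

/-- The substitution `y = -(t e + x / t)` in an integral over the lower orthant below `-t e`. -/
theorem setIntegral_Iic_eq_rescaled (μ : Measure E) [μ.IsAddHaarMeasure] (e : E) (f : E → ℝ)
    {t : ℝ} (ht : 0 < t) :
    t ^ Module.finrank ℝ E * ∫ y in Set.Iic (-(t • e)), f y ∂μ =
      ∫ x in Set.Ici (0 : E), f (-(t • e + t⁻¹ • x)) ∂μ := by
  have key : ∀ x : E, (Set.Iic (-(t • e))).indicator f (-(t • e + t⁻¹ • x)) =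
      (Set.Ici (0 : E)).indicator (fun x => f (-(t • e + t⁻¹ • x))) x := by
    intro x
    have h : (-(t • e + t⁻¹ • x) ∈ Set.Iic (-(t • e))) ↔ x ∈ Set.Ici (0 : E) := by
      simp only [Set.mem_Iic, Set.mem_Ici, neg_le_neg_iff, le_add_iff_nonneg_right]
      constructor
      · intro h
        have := smul_nonneg ht.le h
        rwa [smul_smul, mul_inv_cancel₀ ht.ne', one_smul] at this
      · intro h
        exact smul_nonneg (inv_nonneg.2 ht.le) h
    by_cases hx : x ∈ Set.Ici (0 : E)
    · rw [Set.indicator_of_mem hx, Set.indicator_of_mem (h.2 hx)]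
    · rw [Set.indicator_of_notMem hx, Set.indicator_of_notMem (fun h' => hx (h.1 h'))]
  rw [← integral_indicator measurableSet_Iic, ← integral_indicator measurableSet_Ici]
  simp_rw [← key]
  set g := (Set.Iic (-(t • e))).indicator f with hg
  -- Scaling produces the Jacobian `t ^ finrank`; the shift and the reflection preserve Haar
  -- measure.
  rw [Measure.integral_comp_inv_smul μ (fun x => g (-(t • e + x))) t,
    integral_add_left_eq_self (μ := μ) (fun x => g (-x)) (t • e), integral_neg_eq_self,
    abs_of_pos (by positivity), smul_eq_mul]

/-- A Laplace-type limit for integrals over lower orthants. -/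
theorem tendsto_setIntegral_Iic_div (μ : Measure E) [μ.IsAddHaarMeasure] (e : E) {f : E → ℝ}
    (hf : Measurable f) {N : ℝ → ℝ} {L bound : E → ℝ}
    (hb : IntegrableOn bound (Set.Ici 0) μ)
    (hle : ∀ t ≥ (1 : ℝ), ∀ x ∈ Set.Ici (0 : E), |f (-(t • e + t⁻¹ • x)) / N t| ≤ bound x)
    (hlim : ∀ x ∈ Set.Ici (0 : E),
      Tendsto (fun t => f (-(t • e + t⁻¹ • x)) / N t) atTop (𝓝 (L x))) :
    Tendsto (fun t => t ^ Module.finrank ℝ E * (∫ y in Set.Iic (-(t • e)), f y ∂μ) / N t) atTop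
      (𝓝 (∫ x in Set.Ici (0 : E), L x ∂μ)) := by
  have h := tendsto_integral_filter_of_dominated_convergence (μ := μ.restrict (Set.Ici (0 : E)))
    (l := atTop) (F := fun (t : ℝ) x => f (-(t • e + t⁻¹ • x)) / N t) (f := L) bound
    (Eventually.of_forall fun t => by
      apply Measurable.aestronglyMeasurable
      apply Measurable.div_const
      apply hf.comp
      fun_prop)
    ((eventually_ge_atTop 1).mono fun t ht => (ae_restrict_iff' measurableSet_Ici).2 <|
      Eventually.of_forall fun x hx => hle t ht x hx) hb
    ((ae_restrict_iff' measurableSet_Ici).2 <| Eventually.of_forall hlim)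
  refine h.congr' ((eventually_gt_atTop 0).mono fun t ht => ?_)
  simp only [setIntegral_Iic_eq_rescaled μ e f ht, integral_div]

end Rescaling

/-! ### Gaussian tails with a decaying factor -/

/-- The scale `m` describes the decay of `k` near infinity: `k (t + w / t) / m t` tends to
`exp (-δ w)` for every `w ≥ 0`, with a uniform bound. -/
structure IsTailScale (k m : ℝ → ℝ) (δ : ℝ) : Prop where
  pos : ∀ t ≥ (1 : ℝ), 0 < m t
  abs_le : ∀ t ≥ (1 : ℝ), ∀ w ≥ (0 : ℝ), |k (t + t⁻¹ * w)| ≤ m t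
  tendsto : ∀ w ≥ (0 : ℝ), Tendsto (fun t => k (t + t⁻¹ * w) / m t) atTop (𝓝 (Real.exp (-δ * w)))

theorem tendsto_exp_neg_mul_inv_sq (q : ℝ) :
    Tendsto (fun t : ℝ => Real.exp (-(q * (t⁻¹) ^ 2))) atTop (𝓝 1) := by
  have : Tendsto (fun t : ℝ => -(q * (t⁻¹) ^ 2)) atTop (𝓝 (-(q * 0 ^ 2))) :=
    ((tendsto_inv_atTop_zero.pow 2).const_mul q).neg
  simpa using this.rexp

theorem integral_Ici_exp_neg_mul {a : ℝ} (ha : 0 < a) :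
    ∫ x in Set.Ici (0 : ℝ), Real.exp (-a * x) = 1 / a := by
  rw [integral_Ici_eq_integral_Ioi, integral_exp_mul_Ioi (by linarith)]
  simp

theorem integrableOn_Ici_exp_neg_mul {a : ℝ} (ha : 0 < a) :
    IntegrableOn (fun x => Real.exp (-a * x)) (Set.Ici (0 : ℝ)) := by
  rw [integrableOn_Ici_iff_integrableOn_Ioi]
  exact exp_neg_integrableOn_Ioi 0 ha

/-- At `-(t + x / t)` the exponent `x² / 2` becomes `t² / 2 + x + x² / (2 t²)`, so the rescaled
integrand tends to `exp (-(1 + δ) x)` and is dominated by `exp (-x)`. -/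
theorem gaussian_tail_one_dim {k m : ℝ → ℝ} {δ : ℝ} (hδ : 0 ≤ δ) (hk : Measurable k)
    (h : IsTailScale k m δ) :
    Tendsto (fun t => t * (∫ x in Set.Iic (-t), Real.exp (-x ^ 2 / 2) * k (-x)) /
      (Real.exp (-t ^ 2 / 2) * m t)) atTop (𝓝 (1 / (1 + δ))) := by
  have e1 : ∀ t ≥ (1 : ℝ), ∀ x : ℝ, Real.exp (-(-(t * 1 + t⁻¹ * x)) ^ 2 / 2) *
      k (-(-(t * 1 + t⁻¹ * x))) / (Real.exp (-t ^ 2 / 2) * m t) =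
      Real.exp (-1 * x) * Real.exp (-(x ^ 2 / 2 * (t⁻¹) ^ 2)) * (k (t + t⁻¹ * x) / m t) := by
    intro t ht x
    have : Real.exp (-(-(t * 1 + t⁻¹ * x)) ^ 2 / 2) =
        Real.exp (-t ^ 2 / 2) * (Real.exp (-1 * x) * Real.exp (-(x ^ 2 / 2 * (t⁻¹) ^ 2))) := by
      rw [← Real.exp_add, ← Real.exp_add]
      congr 1
      field_simp
      ring
    rw [this, neg_neg, mul_one]
    have := (Real.exp_pos (-t ^ 2 / 2)).ne'
    have := (h.pos t ht).ne'
    field_simp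
  have key := tendsto_setIntegral_Iic_div (volume : Measure ℝ) (1 : ℝ)
    (f := fun x => Real.exp (-x ^ 2 / 2) * k (-x)) (by fun_prop)
    (N := fun t => Real.exp (-t ^ 2 / 2) * m t) (L := fun x => Real.exp (-(1 + δ) * x))
    (bound := fun x => Real.exp (-1 * x)) (integrableOn_Ici_exp_neg_mul one_pos) ?_ ?_
  · rw [integral_Ici_exp_neg_mul (by linarith)] at key
    simpa using key
  · intro t ht x hx
    simp only [smul_eq_mul]
    rw [e1 t ht x, abs_mul, abs_of_pos (by positivity), abs_div, abs_of_pos (h.pos t ht), mul_assoc]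
    apply mul_le_of_le_one_right (by positivity)
    apply mul_le_one₀ _ (by have := h.pos t ht; positivity)
    · rw [div_le_one (h.pos t ht)]
      exact h.abs_le t ht x hx
    · rw [Real.exp_le_one_iff]
      have : 0 ≤ x ^ 2 / 2 * t⁻¹ ^ 2 := by positivity
      linarith
  · intro x hx
    have h1 := ((tendsto_exp_neg_mul_inv_sq (x ^ 2 / 2)).const_mul (Real.exp (-1 * x))).mul
      (h.tendsto x hx)
    have h2 : Real.exp (-1 * x) * 1 * Real.exp (-δ * x) = Real.exp (-(1 + δ) * x) := by
      rw [mul_one, ← Real.exp_add]; congr 1; ring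
    rw [h2] at h1
    refine h1.congr' ((eventually_ge_atTop 1).mono fun t ht => ?_)
    simp only [smul_eq_mul]
    rw [e1 t ht x]

/-- Since `R⁻¹ (1, 1) = (1, 1) / (1 + ρ)`, the cross term in the exponent is `(x 0 + x 1) / (1 +
ρ)`. The factor `k` sees only the mean of the coordinates, hence `δ / 2` for each; the limit
integral is a product, which explains the square. -/
theorem gaussian_tail_two_dim {k m : ℝ → ℝ} {δ ρ : ℝ} (hδ : 0 ≤ δ) (hρ₁ : -1 < ρ) (hρ₂ : ρ < 1)
    (hk : Measurable k) (h : IsTailScale k m δ) :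
    Tendsto (fun t => t ^ 2 * (∫ x in Set.Iic (fun _ : Fin 2 => -t),
        Real.exp (-(x 0 ^ 2 - 2 * ρ * x 0 * x 1 + x 1 ^ 2) / (2 * (1 - ρ ^ 2))) *
          k (-((x 0 + x 1) / 2))) /
      (Real.exp (-t ^ 2 / (1 + ρ)) * m t)) atTop (𝓝 ((1 / (1 / (1 + ρ) + δ / 2)) ^ 2)) := by
  have hρ : 0 < 1 + ρ := by linarith
  have hρ' : 0 < 1 - ρ := by linarith
  have hρ2 : 1 - ρ ^ 2 = (1 - ρ) * (1 + ρ) := by ring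
  set Q : (Fin 2 → ℝ) → ℝ :=
    fun x => (x 0 ^ 2 - 2 * ρ * x 0 * x 1 + x 1 ^ 2) / (2 * (1 - ρ ^ 2)) with hQ
  have hQ0 : ∀ x, 0 ≤ Q x := by
    intro x
    apply div_nonneg _ (by rw [hρ2]; positivity)
    -- Twice the form is `(1 + ρ) (x 0 - x 1)² + (1 - ρ) (x 0 + x 1)²`.
    nlinarith [mul_nonneg hρ.le (sq_nonneg (x 0 - x 1)), mul_nonneg hρ'.le (sq_nonneg (x 0 + x 1))]
  have e1 : ∀ t ≥ (1 : ℝ), ∀ x : Fin 2 → ℝ,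
      Real.exp (-Q (-(t • (1 : Fin 2 → ℝ) + t⁻¹ • x))) *
      k (-(((-(t • (1 : Fin 2 → ℝ) + t⁻¹ • x)) 0 + (-(t • (1 : Fin 2 → ℝ) + t⁻¹ • x)) 1) / 2)) /
        (Real.exp (-t ^ 2 / (1 + ρ)) * m t) =
      Real.exp (-(1 / (1 + ρ)) * (x 0 + x 1)) * Real.exp (-(Q x * (t⁻¹) ^ 2)) *
        (k (t + t⁻¹ * ((x 0 + x 1) / 2)) / m t) := by
    intro t ht x
    have : Real.exp (-Q (-(t • (1 : Fin 2 → ℝ) + t⁻¹ • x))) =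
        Real.exp (-t ^ 2 / (1 + ρ)) * (Real.exp (-(1 / (1 + ρ)) * (x 0 + x 1)) *
          Real.exp (-(Q x * (t⁻¹) ^ 2))) := by
      rw [← Real.exp_add, ← Real.exp_add]
      congr 1
      simp only [hQ, Pi.neg_apply, Pi.add_apply, Pi.smul_apply, smul_eq_mul, Pi.one_apply, hρ2]
      field_simp
      ring
    have h2 : -(((-(t • (1 : Fin 2 → ℝ) + t⁻¹ • x)) 0 + (-(t • (1 : Fin 2 → ℝ) + t⁻¹ • x)) 1) / 2)
        = t + t⁻¹ * ((x 0 + x 1) / 2) := by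
      simp only [Pi.neg_apply, Pi.add_apply, Pi.smul_apply, smul_eq_mul, Pi.one_apply]
      ring
    rw [this, h2]
    have := (Real.exp_pos (-t ^ 2 / (1 + ρ))).ne'
    have := (h.pos t ht).ne'
    field_simp
  have hind : ∀ a : ℝ, (Set.Ici (0 : Fin 2 → ℝ)).indicator (fun x => Real.exp (-a * (x 0 + x 1))) =
      fun x => ∏ i : Fin 2, (Set.Ici (0 : ℝ)).indicator (fun x => Real.exp (-a * x)) (x i) := by
    intro a
    ext x
    rw [Fin.prod_univ_two]
    by_cases hx : x ∈ Set.Ici (0 : Fin 2 → ℝ)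
    · have h0 : x 0 ∈ Set.Ici (0 : ℝ) := hx 0
      have h1 : x 1 ∈ Set.Ici (0 : ℝ) := hx 1
      rw [Set.indicator_of_mem hx, Set.indicator_of_mem h0, Set.indicator_of_mem h1,
        ← Real.exp_add]
      congr 1; ring
    · rw [Set.indicator_of_notMem hx]
      have : x 0 ∉ Set.Ici (0 : ℝ) ∨ x 1 ∉ Set.Ici (0 : ℝ) := by
        by_contra! hc
        exact hx (fun i => by fin_cases i; exacts [hc.1, hc.2])
      rcases this with h | h <;> rw [Set.indicator_of_notMem h] <;> simp
  have key := tendsto_setIntegral_Iic_div (volume : Measure (Fin 2 → ℝ)) (1 : Fin 2 → ℝ)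
    (f := fun x => Real.exp (-Q x) * k (-((x 0 + x 1) / 2))) (by fun_prop)
    (N := fun t => Real.exp (-t ^ 2 / (1 + ρ)) * m t)
    (L := fun x => Real.exp (-(1 / (1 + ρ) + δ / 2) * (x 0 + x 1)))
    (bound := fun x => Real.exp (-(1 / (1 + ρ)) * (x 0 + x 1))) ?_ ?_ ?_
  · rw [← integral_indicator measurableSet_Ici, hind, integral_fintype_prod_volume_eq_prod,
      Fin.prod_univ_two, integral_indicator measurableSet_Ici,
      integral_Ici_exp_neg_mul (by positivity), ← pow_two] at key
    refine key.congr fun t => ?_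
    have : -(t • (1 : Fin 2 → ℝ)) = fun _ => -t := by ext i; simp
    rw [this]
    simp only [hQ, neg_div, Module.finrank_fin_fun]
  · rw [← integrable_indicator_iff measurableSet_Ici, hind]
    exact Integrable.fintype_prod (f := fun _ => (Set.Ici (0 : ℝ)).indicator _) fun _ =>
      (integrable_indicator_iff measurableSet_Ici).2 (integrableOn_Ici_exp_neg_mul (by positivity))
  · intro t ht x hx
    have hx0 : 0 ≤ x 0 := hx 0
    have hx1 : 0 ≤ x 1 := hx 1
    rw [e1 t ht x, abs_mul, abs_of_pos (by positivity), abs_div, abs_of_pos (h.pos t ht), mul_assoc]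
    apply mul_le_of_le_one_right (by positivity)
    apply mul_le_one₀ _ (by have := h.pos t ht; positivity)
    · rw [div_le_one (h.pos t ht)]
      exact h.abs_le t ht _ (by positivity)
    · rw [Real.exp_le_one_iff]
      have : 0 ≤ Q x * t⁻¹ ^ 2 := mul_nonneg (hQ0 x) (by positivity)
      linarith
  · intro x hx
    have hx0 : 0 ≤ x 0 := hx 0
    have hx1 : 0 ≤ x 1 := hx 1
    have h1 := ((tendsto_exp_neg_mul_inv_sq (Q x)).const_mul
      (Real.exp (-(1 / (1 + ρ)) * (x 0 + x 1)))).mul (h.tendsto ((x 0 + x 1) / 2) (by positivity))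
    have h2 : Real.exp (-(1 / (1 + ρ)) * (x 0 + x 1)) * 1 * Real.exp (-δ * ((x 0 + x 1) / 2)) =
        Real.exp (-(1 / (1 + ρ) + δ / 2) * (x 0 + x 1)) := by
      rw [mul_one, ← Real.exp_add]; congr 1; ring
    rw [h2] at h1
    refine h1.congr' ((eventually_ge_atTop 1).mono fun t ht => ?_)
    exact (e1 t ht x).symm

/-! ### The standard normal cdf and its tail scales -/

theorem stdNormalCDF_nonneg (z : ℝ) : 0 ≤ stdNormalCDF z := cdf_nonneg _ z

theorem stdNormalCDF_le_one (z : ℝ) : stdNormalCDF z ≤ 1 := cdf_le_one _ z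

theorem monotone_stdNormalCDF : Monotone stdNormalCDF := monotone_cdf _

theorem measurable_stdNormalCDF : Measurable stdNormalCDF := monotone_stdNormalCDF.measurable

theorem ofReal_stdNormalCDF (z : ℝ) :
    ENNReal.ofReal (stdNormalCDF z) = gaussianReal 0 1 (Set.Iic z) := ofReal_cdf _ z

theorem gaussianPDFReal_zero_one (x : ℝ) :
    gaussianPDFReal 0 1 x = (√(2 * Real.pi))⁻¹ * Real.exp (-x ^ 2 / 2) := by
  simp [gaussianPDFReal]

theorem stdNormalCDF_eq_setIntegral (z : ℝ) :
    stdNormalCDF z = (√(2 * Real.pi))⁻¹ * ∫ x in Set.Iic z, Real.exp (-x ^ 2 / 2) := by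
  rw [stdNormalCDF, cdf_eq_real, Measure.real, gaussianReal_apply_eq_integral 0 one_ne_zero,
    ENNReal.toReal_ofReal (integral_nonneg fun x => gaussianPDFReal_nonneg _ _ _)]
  simp_rw [gaussianPDFReal_zero_one]
  rw [integral_const_mul]

/-- The upper bound in Mills' inequality. -/
theorem stdNormalCDF_neg_le {z : ℝ} (hz : 0 < z) :
    stdNormalCDF (-z) ≤ Real.exp (-z ^ 2 / 2) / (√(2 * Real.pi) * z) := by
  have h := setIntegral_Iic_eq_rescaled (volume : Measure ℝ) (1 : ℝ)
    (fun x => Real.exp (-x ^ 2 / 2)) hz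
  simp only [Module.finrank_self, pow_one, smul_eq_mul, mul_one] at h
  -- The bound drops the nonnegative term `(x / z)²` from the squared argument.
  have h2 : ∫ x in Set.Ici (0 : ℝ), Real.exp (-(-(z + z⁻¹ * x)) ^ 2 / 2) ≤
      ∫ x in Set.Ici (0 : ℝ), Real.exp (-z ^ 2 / 2) * Real.exp (-1 * x) := by
    apply integral_mono_of_nonneg (Eventually.of_forall fun x => (Real.exp_pos _).le)
      ((integrableOn_Ici_exp_neg_mul one_pos).const_mul _)
    refine Eventually.of_forall fun x => ?_
    simp only
    rw [← Real.exp_add, Real.exp_le_exp]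
    have h3 : (z + z⁻¹ * x) ^ 2 = z ^ 2 + 2 * x + (z⁻¹ * x) ^ 2 := by
      field_simp
      ring
    rw [neg_sq, h3]
    nlinarith [sq_nonneg (z⁻¹ * x)]
  rw [integral_const_mul, integral_Ici_exp_neg_mul one_pos, ← h, div_one, mul_one] at h2
  have hs : 0 < √(2 * Real.pi) := by positivity
  rw [stdNormalCDF_eq_setIntegral, le_div_iff₀ (by positivity)]
  calc _ = z * ∫ x in Set.Iic (-z), Real.exp (-x ^ 2 / 2) := by field_simp
    _ ≤ _ := h2

theorem tendsto_mills :
    Tendsto (fun z => stdNormalCDF (-z) * (√(2 * Real.pi) * z) / Real.exp (-z ^ 2 / 2)) atTop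
      (𝓝 1) := by
  have h := gaussian_tail_one_dim (k := fun _ => 1) (m := fun _ => 1) le_rfl measurable_const
    ⟨fun _ _ => one_pos, fun _ _ _ _ => by simp, fun w _ => by simp⟩
  simp only [mul_one, add_zero, div_one] at h
  refine h.congr fun z => ?_
  have hs : 0 < √(2 * Real.pi) := by positivity
  rw [stdNormalCDF_eq_setIntegral]
  field_simp

/-- Mills' inequality gives the uniform bound and the Mills limit the convergence; the rate `c ^ 2`
is the cross term of `(c (t + w / t))² / 2`. -/
theorem isTailScale_stdNormalCDF_of_pos {c : ℝ} (hc : 0 < c) :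
    IsTailScale (fun s => stdNormalCDF (-(c * s)))
      (fun t => Real.exp (-(c * t) ^ 2 / 2) / (√(2 * Real.pi) * (c * t))) (c ^ 2) where
  pos t ht := by positivity
  abs_le t ht w hw := by
    rw [abs_of_nonneg (stdNormalCDF_nonneg _)]
    refine le_trans (monotone_stdNormalCDF ?_) (stdNormalCDF_neg_le (by positivity))
    have : 0 ≤ c * (t⁻¹ * w) := by positivity
    linarith
  tendsto w hw := by
    have hz : Tendsto (fun t : ℝ => c * (t + t⁻¹ * w)) atTop atTop := by
      apply Tendsto.const_mul_atTop hc
      refine tendsto_atTop_mono' _ ?_ tendsto_id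
      filter_upwards [eventually_gt_atTop 0] with t ht
      have : 0 ≤ t⁻¹ * w := by positivity
      simp only [id]; linarith
    have h1 := tendsto_mills.comp hz
    have h2 := (tendsto_exp_neg_mul_inv_sq (c ^ 2 * w ^ 2 / 2)).const_mul (Real.exp (-c ^ 2 * w))
    have h3 : Tendsto (fun t : ℝ => (1 + w * (t⁻¹) ^ 2)⁻¹) atTop (𝓝 ((1 + w * 0 ^ 2)⁻¹)) :=
      (((tendsto_inv_atTop_zero.pow 2).const_mul w).const_add 1).inv₀ (by simp)
    have h4 := (h1.mul h2).mul h3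
    simp only [ne_eq, OfNat.ofNat_ne_zero, not_false_eq_true, zero_pow, mul_zero, add_zero,
      inv_one, mul_one, one_mul] at h4
    refine h4.congr' ?_
    filter_upwards [eventually_gt_atTop 0] with t ht
    simp only [Function.comp]
    have e : Real.exp (-(c * (t + t⁻¹ * w)) ^ 2 / 2) = Real.exp (-(c * t) ^ 2 / 2) *
        (Real.exp (-c ^ 2 * w) * Real.exp (-(c ^ 2 * w ^ 2 / 2 * t⁻¹ ^ 2))) := by
      rw [← Real.exp_add, ← Real.exp_add]
      congr 1
      field_simp
      ring
    rw [e]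
    have e2 : t + t⁻¹ * w = t * (1 + w * t⁻¹ ^ 2) := by field_simp
    have hs : 0 < √(2 * Real.pi) := by positivity
    have h5 : 0 < 1 + w * t⁻¹ ^ 2 := by positivity
    have h6 := Real.exp_pos (-(c * t) ^ 2 / 2)
    have h7 := Real.exp_pos (-c ^ 2 * w)
    have h8 := Real.exp_pos (-(c ^ 2 * w ^ 2 / 2 * t⁻¹ ^ 2))
    rw [e2]
    generalize Real.exp (-(c * t) ^ 2 / 2) = E₁ at *
    generalize Real.exp (-c ^ 2 * w) = E₂ at *
    generalize Real.exp (-(c ^ 2 * w ^ 2 / 2 * t⁻¹ ^ 2)) = E₃ at *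
    generalize stdNormalCDF _ = S
    generalize 1 + w * t⁻¹ ^ 2 = D at *
    field_simp

theorem isTailScale_stdNormalCDF_of_neg {c : ℝ} (hc : c < 0) :
    IsTailScale (fun s => stdNormalCDF (-(c * s))) (fun _ => 1) 0 where
  pos t ht := one_pos
  abs_le t ht w hw := by
    rw [abs_of_nonneg (stdNormalCDF_nonneg _)]
    exact stdNormalCDF_le_one _
  tendsto w hw := by
    have hz : Tendsto (fun t : ℝ => -c * (t + t⁻¹ * w)) atTop atTop := by
      apply Tendsto.const_mul_atTop (by linarith)
      refine tendsto_atTop_mono' _ ?_ tendsto_id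
      filter_upwards [eventually_gt_atTop 0] with t ht
      have : 0 ≤ t⁻¹ * w := by positivity
      simp only [id]; linarith
    have h := (tendsto_cdf_atTop (gaussianReal 0 1)).comp hz
    simpa [stdNormalCDF, Function.comp_def] using h

/-! ### Marginals of the bivariate skew normal law -/

theorem gaussianReal_Iic (μ : ℝ) {v : NNReal} (hv : v ≠ 0) (s : ℝ) :
    gaussianReal μ v (Set.Iic s) = ENNReal.ofReal (stdNormalCDF ((s - μ) / √v)) := by
  have hv' : (0 : ℝ) < v := by positivity
  have h : gaussianReal μ v =
      ((gaussianReal 0 1).map (fun x => √v * x)).map (fun x => x + μ) := by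
    rw [gaussianReal_map_const_mul, gaussianReal_map_add_const]
    congr 1
    · simp
    · ext; simp
  rw [h, Measure.map_apply (by fun_prop) measurableSet_Iic,
    Measure.map_apply (by fun_prop) (measurableSet_Iic.preimage (by fun_prop)),
    ofReal_stdNormalCDF]
  congr 1
  ext x
  simp only [Set.mem_preimage, Set.mem_Iic]
  rw [le_div_iff₀ (by positivity), le_sub_iff_add_le, mul_comm]

/-- With `W` standard normal and independent of `Y`, the integral is `P(W ≤ θ (x + Y)) = P(W - θ Y ≤
θ x)`, and `W - θ Y` is Gaussian with mean `-θ μ` and variance `1 + θ² v`. -/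
theorem lintegral_stdNormalCDF (θ x μ : ℝ) (v : NNReal) :
    ∫⁻ y, ENNReal.ofReal (stdNormalCDF (θ * (x + y))) ∂(gaussianReal μ v) =
      ENNReal.ofReal (stdNormalCDF (θ * (x + μ) / √(1 + θ ^ 2 * v))) := by
  have h1 : (gaussianReal μ v).map (fun y => -θ * y) ∗ gaussianReal 0 1 =
      gaussianReal (-θ * μ) (NNReal.mk (θ ^ 2) (sq_nonneg θ) * v + 1) := by
    rw [gaussianReal_map_const_mul, gaussianReal_conv_gaussianReal, add_zero]
    congr 3
    ext; simp
  have h2 := congrArg (fun m => m (Set.Iic (θ * x))) h1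
  rw [gaussianReal_Iic _ (by positivity), ← lintegral_indicator_one measurableSet_Iic,
    Measure.lintegral_conv (measurable_one.indicator measurableSet_Iic)] at h2
  have h3 : ∀ y, ∫⁻ w, (Set.Iic (θ * x)).indicator (1 : ℝ → ENNReal) (y + w) ∂(gaussianReal 0 1) =
      ENNReal.ofReal (stdNormalCDF (θ * x - y)) := by
    intro y
    rw [ofReal_stdNormalCDF, ← lintegral_indicator_one measurableSet_Iic]
    congr 1
    ext w
    by_cases hw : w ≤ θ * x - y
    · rw [Set.indicator_of_mem (by simpa using by linarith), Set.indicator_of_mem (by simpa using hw)]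
      rfl
    · rw [Set.indicator_of_notMem (by simp; linarith), Set.indicator_of_notMem (by simpa using hw)]
  simp_rw [h3] at h2
  rw [lintegral_map (by
    have := measurable_stdNormalCDF
    fun_prop) (by fun_prop)] at h2
  convert h2 using 2
  · ext y; congr 2; ring
  · congr 1
    push_cast
    congr 1
    · ring
    · rw [add_comm]

theorem det_corrMatrix (ρ : ℝ) : (corrMatrix ρ).det = 1 - ρ ^ 2 := by
  rw [corrMatrix, Matrix.det_fin_two_of]; ring

theorem normalPDF₂_corrMatrix {ρ : ℝ} (hρ₁ : -1 < ρ) (hρ₂ : ρ < 1) (x : Fin 2 → ℝ) :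
    normalPDF₂ (corrMatrix ρ) x = (2 * Real.pi * √(1 - ρ ^ 2))⁻¹ *
      Real.exp (-(x 0 ^ 2 - 2 * ρ * x 0 * x 1 + x 1 ^ 2) / (2 * (1 - ρ ^ 2))) := by
  have h : 0 < 1 - ρ ^ 2 := by nlinarith
  rw [normalPDF₂, det_corrMatrix, Matrix.inv_def, det_corrMatrix, corrMatrix,
    Matrix.adjugate_fin_two_of, Ring.inverse_eq_inv']
  congr 2
  simp [dotProduct, Matrix.mulVec, Fin.sum_univ_two]
  field_simp
  ring

theorem skewNormalPDF₂_eq {ρ : ℝ} (hρ₁ : -1 < ρ) (hρ₂ : ρ < 1) (θ : ℝ) (x : Fin 2 → ℝ) :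
    skewNormalPDF₂ ![θ, θ] (corrMatrix ρ) x = (Real.pi * √(1 - ρ ^ 2))⁻¹ *
      (Real.exp (-(x 0 ^ 2 - 2 * ρ * x 0 * x 1 + x 1 ^ 2) / (2 * (1 - ρ ^ 2))) *
        stdNormalCDF (θ * (x 0 + x 1))) := by
  rw [skewNormalPDF₂, normalPDF₂_corrMatrix hρ₁ hρ₂]
  have : ![θ, θ] ⬝ᵥ x = θ * (x 0 + x 1) := by
    simp [dotProduct, Fin.sum_univ_two]; ring
  rw [this, mul_assoc 2 Real.pi, mul_inv]
  ring

theorem measurable_skewNormalPDF₂ {ρ : ℝ} (hρ₁ : -1 < ρ) (hρ₂ : ρ < 1) (θ : ℝ) :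
    Measurable (skewNormalPDF₂ ![θ, θ] (corrMatrix ρ)) := by
  have := measurable_stdNormalCDF
  rw [funext (skewNormalPDF₂_eq hρ₁ hρ₂ θ)]
  fun_prop

/-- The univariate skew normal density `2 φ(x) Φ(l x)`. -/
noncomputable def skewNormalPDF (l x : ℝ) : ℝ := 2 * gaussianPDFReal 0 1 x * stdNormalCDF (l * x)

theorem skewNormalPDF_nonneg (l x : ℝ) : 0 ≤ skewNormalPDF l x :=
  mul_nonneg (mul_nonneg zero_le_two (gaussianPDFReal_nonneg _ _ _)) (stdNormalCDF_nonneg _)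

theorem measurable_skewNormalPDF (l : ℝ) : Measurable (skewNormalPDF l) := by
  have := measurable_stdNormalCDF
  unfold skewNormalPDF
  fun_prop

/-- The bivariate normal density is `φ(x)` times the density in `y` of the conditional law `N(ρ x, 1
- ρ²)`; averaging `Φ` over that law produces the constant `λ`. -/
theorem lintegral_skewNormalPDF₂ {ρ : ℝ} (hρ₁ : -1 < ρ) (hρ₂ : ρ < 1) (θ x : ℝ) :
    ∫⁻ y, ENNReal.ofReal (skewNormalPDF₂ ![θ, θ] (corrMatrix ρ) ![x, y]) =
      ENNReal.ofReal (skewNormalPDF (lam θ ρ) x) := by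
  have h : 0 < 1 - ρ ^ 2 := by nlinarith
  set v : NNReal := ⟨1 - ρ ^ 2, h.le⟩ with hv
  have hvr : (v : ℝ) = 1 - ρ ^ 2 := rfl
  have hv0 : v ≠ 0 := by
    intro h0
    rw [h0] at hvr
    simp at hvr
    linarith
  have hpdf : ∀ y, ENNReal.ofReal (skewNormalPDF₂ ![θ, θ] (corrMatrix ρ) ![x, y]) =
      ENNReal.ofReal (2 * gaussianPDFReal 0 1 x) *
        (gaussianPDF (ρ * x) v y * ENNReal.ofReal (stdNormalCDF (θ * (x + y)))) := by
    intro y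
    rw [gaussianPDF, ← ENNReal.ofReal_mul (gaussianPDFReal_nonneg _ _ _),
      ← ENNReal.ofReal_mul (mul_nonneg zero_le_two (gaussianPDFReal_nonneg _ _ _)),
      skewNormalPDF₂_eq hρ₁ hρ₂, gaussianPDFReal_zero_one, gaussianPDFReal, hvr]
    congr 1
    simp only [Matrix.cons_val_zero, Matrix.cons_val_one]
    rw [Real.sqrt_mul (by positivity : 0 ≤ 2 * Real.pi)]
    have e : Real.exp (-(x ^ 2 - 2 * ρ * x * y + y ^ 2) / (2 * (1 - ρ ^ 2))) =
        Real.exp (-x ^ 2 / 2) * Real.exp (-(y - ρ * x) ^ 2 / (2 * (1 - ρ ^ 2))) := by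
      rw [← Real.exp_add]
      congr 1
      field_simp
      ring
    rw [e]
    have hs : (√(2 * Real.pi))⁻¹ * (√(2 * Real.pi))⁻¹ = (2 * Real.pi)⁻¹ := by
      rw [← mul_inv, Real.mul_self_sqrt (by positivity)]
    calc _ = 2 * (2 * Real.pi)⁻¹ * (√(1 - ρ ^ 2))⁻¹ * (Real.exp (-x ^ 2 / 2) *
          Real.exp (-(y - ρ * x) ^ 2 / (2 * (1 - ρ ^ 2)))) * stdNormalCDF (θ * (x + y)) := by
            rw [mul_inv, mul_inv]; ring
      _ = _ := by rw [← hs, mul_inv]; ring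
  have hmeas : Measurable fun y => ENNReal.ofReal (stdNormalCDF (θ * (x + y))) := by
    have := measurable_stdNormalCDF
    fun_prop
  simp_rw [hpdf]
  have hwd := lintegral_withDensity_eq_lintegral_mul volume (measurable_gaussianPDF (ρ * x) v) hmeas
  simp only [Pi.mul_apply] at hwd
  rw [lintegral_const_mul _ (by fun_prop), ← hwd, ← gaussianReal_of_var_ne_zero _ hv0,
    lintegral_stdNormalCDF,
    ← ENNReal.ofReal_mul (mul_nonneg zero_le_two (gaussianPDFReal_nonneg _ _ _)), skewNormalPDF,
    hvr, lam]
  congr 3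
  ring

theorem skewNormal₂_marginal {ρ : ℝ} (hρ₁ : -1 < ρ) (hρ₂ : ρ < 1) (θ : ℝ) (i : Fin 2) {s : Set ℝ}
    (hs : MeasurableSet s) :
    skewNormal₂ ![θ, θ] (corrMatrix ρ) {x | x i ∈ s} =
      ∫⁻ x in s, ENNReal.ofReal (skewNormalPDF (lam θ ρ) x) := by
  have hm : Measurable fun p : ℝ × ℝ =>
      ENNReal.ofReal (skewNormalPDF₂ ![θ, θ] (corrMatrix ρ) ![p.1, p.2]) := by
    apply ENNReal.measurable_ofReal.comp
    apply (measurable_skewNormalPDF₂ hρ₁ hρ₂ θ).comp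
    exact (MeasurableEquiv.finTwoArrow (α := ℝ)).symm.measurable
  have hx : ∀ x : Fin 2 → ℝ, ![x 0, x 1] = x := fun x => by ext j; fin_cases j <;> rfl
  have hmp := volume_preserving_finTwoArrow ℝ
  have hsm : MeasurableSet {x : Fin 2 → ℝ | x i ∈ s} := measurable_pi_apply i hs
  rw [skewNormal₂, withDensity_apply _ hsm]
  fin_cases i
  · have h := hmp.setLIntegral_comp_preimage (hs.prod MeasurableSet.univ) hm
    have hset : MeasurableEquiv.finTwoArrow ⁻¹' (s ×ˢ (Set.univ : Set ℝ)) =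
        {x : Fin 2 → ℝ | x 0 ∈ s} := by ext x; simp
    rw [hset] at h
    simp only [MeasurableEquiv.finTwoArrow_apply, hx] at h
    simp only [Fin.zero_eta]
    rw [h, Measure.volume_eq_prod, ← Measure.prod_restrict, Measure.restrict_univ,
      lintegral_prod _ hm.aemeasurable]
    simp_rw [lintegral_skewNormalPDF₂ hρ₁ hρ₂]
  · have h := hmp.setLIntegral_comp_preimage (MeasurableSet.univ.prod hs) hm
    have hset : MeasurableEquiv.finTwoArrow ⁻¹' ((Set.univ : Set ℝ) ×ˢ s) =
        {x : Fin 2 → ℝ | x 1 ∈ s} := by ext x; simp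
    rw [hset] at h
    simp only [MeasurableEquiv.finTwoArrow_apply, hx] at h
    simp only [Fin.mk_one]
    -- Equal skewness makes the density symmetric, so the second marginal reduces to the first.
    have hswap : ∀ x y, skewNormalPDF₂ ![θ, θ] (corrMatrix ρ) ![x, y] =
        skewNormalPDF₂ ![θ, θ] (corrMatrix ρ) ![y, x] := by
      intro x y
      rw [skewNormalPDF₂_eq hρ₁ hρ₂, skewNormalPDF₂_eq hρ₁ hρ₂]
      simp only [Matrix.cons_val_zero, Matrix.cons_val_one]
      rw [add_comm x y]
      ring_nf
    rw [h, Measure.volume_eq_prod, ← Measure.prod_restrict, Measure.restrict_univ,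
      lintegral_prod_symm _ hm.aemeasurable]
    simp_rw [hswap _, lintegral_skewNormalPDF₂ hρ₁ hρ₂]

/-! ### Eliminating the threshold -/

/-- If `U t ~ c₁ t ^ (-p) exp (-a t²)` and `G t ~ c₂ t ^ (-q) exp (-b t²)` at infinity, then
`G / U` is asymptotically explicit as a function of `u = U t`. -/
theorem isEquivalent_of_gaussian_tails {U G T : ℝ → ℝ} {c₁ c₂ a b p q : ℝ} (hc₁ : 0 < c₁)
    (hc₂ : 0 < c₂) (ha : 0 < a)
    (hU : Tendsto (fun t => U t * t ^ p * Real.exp (a * t ^ 2)) atTop (𝓝 c₁))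
    (hG : Tendsto (fun t => G t * t ^ q * Real.exp (b * t ^ 2)) atTop (𝓝 c₂))
    (hT : Tendsto T (𝓝[>] 0) atTop) (hUT : ∀ᶠ u in 𝓝[>] 0, U (T u) = u) :
    (fun u => G (T u) / u) ~[𝓝[>] 0] fun u =>
      c₂ * c₁ ^ (-(b / a)) * a ^ (-((p * (b / a) - q) / 2)) * u ^ (b / a - 1) *
        (-Real.log u) ^ ((p * (b / a) - q) / 2) := by
  set r := (p * (b / a) - q) / 2 with hr
  have hlogt : Tendsto (fun t : ℝ => Real.log t / t ^ 2) atTop (𝓝 0) := by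
    have := (isLittleO_log_rpow_atTop (r := 2) (by norm_num)).tendsto_div_nhds_zero
    simpa using this
  have hsq : Tendsto (fun t : ℝ => (t ^ 2)⁻¹) atTop (𝓝 0) :=
    (tendsto_pow_atTop (by norm_num)).inv_tendsto_atTop
  have hV : Tendsto (fun u => u * (T u) ^ p * Real.exp (a * (T u) ^ 2)) (𝓝[>] 0) (𝓝 c₁) :=
    (hU.comp hT).congr' (hUT.mono fun u hu => by simp only [Function.comp, hu])
  have hpos : ∀ᶠ u in 𝓝[>] (0 : ℝ), 0 < u ∧ u < 1 ∧ 0 < T u := by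
    filter_upwards [Ioo_mem_nhdsGT (zero_lt_one' ℝ), hT.eventually (eventually_gt_atTop 0)]
      with u hu hTu
    exact ⟨hu.1, hu.2, hTu⟩
  -- Take the logarithm of `hV` and divide by `(T u)²`: the bounded part and `log (T u)` disappear.
  have hlog : Tendsto (fun u => -Real.log u / (T u) ^ 2) (𝓝[>] 0) (𝓝 a) := by
    have h1 : Tendsto (fun u => Real.log (u * (T u) ^ p * Real.exp (a * (T u) ^ 2)))
        (𝓝[>] 0) (𝓝 (Real.log c₁)) := hV.log hc₁.ne'
    have h2 := (((h1.mul (hsq.comp hT)).neg).add ((hlogt.comp hT).const_mul p)).add_const a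
    simp only [mul_zero, neg_zero, zero_add] at h2
    refine h2.congr' (hpos.mono fun u ⟨hu, _, hTu⟩ => ?_)
    simp only [Function.comp]
    rw [Real.log_mul (by positivity) (by positivity), Real.log_mul (by positivity) (by positivity),
      Real.log_exp, Real.log_rpow hTu]
    field_simp
    ring
  have hlogr : Tendsto (fun u => (-Real.log u / (T u) ^ 2) ^ (-r)) (𝓝[>] 0) (𝓝 (a ^ (-r))) :=
    hlog.rpow_const (Or.inl ha.ne')
  have hVr : Tendsto (fun u => (u * (T u) ^ p * Real.exp (a * (T u) ^ 2)) ^ (-(b / a)))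
      (𝓝[>] 0) (𝓝 (c₁ ^ (-(b / a)))) := hV.rpow_const (Or.inl hc₁.ne')
  have hK : 0 < c₂ * c₁ ^ (-(b / a)) * a ^ (-r) := by positivity
  -- In this product the exponentials and all powers of `T u` cancel, since `2 r = p (b / a) - q`.
  have hall := (((hG.comp hT).mul hVr).mul hlogr).div_const (c₂ * c₁ ^ (-(b / a)) * a ^ (-r))
  rw [div_self hK.ne'] at hall
  apply isEquivalent_of_tendsto_one
  refine hall.congr' (hpos.mono fun u ⟨hu, hu1, hTu⟩ => ?_)
  have hl : 0 < -Real.log u := by have := Real.log_neg hu hu1; linarith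
  simp only [Function.comp, Pi.div_apply]
  set t := T u
  set l := -Real.log u
  have e1 : (u * t ^ p * Real.exp (a * t ^ 2)) ^ (-(b / a)) =
      u ^ (-(b / a)) * t ^ (-(p * (b / a))) * Real.exp (-(b * t ^ 2)) := by
    rw [Real.mul_rpow (by positivity) (by positivity), Real.mul_rpow (by positivity) (by positivity),
      ← Real.rpow_mul hTu.le, ← Real.exp_mul]
    congr 2
    · ring_nf
    · field_simp
  have e2 : (l / t ^ 2) ^ (-r) = l ^ (-r) * (t ^ (p * (b / a)) * t ^ (-q)) := by
    rw [Real.div_rpow hl.le (by positivity), div_eq_mul_inv, ← Real.rpow_neg (by positivity),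
      neg_neg, ← Real.rpow_natCast t 2, ← Real.rpow_mul hTu.le, ← Real.rpow_add hTu]
    congr 2
    rw [hr]; push_cast; ring
  have e3 : u ^ (b / a - 1) = u ^ (b / a) / u := by rw [Real.rpow_sub hu, Real.rpow_one]
  rw [e1, e2, e3, Real.rpow_neg hu.le, Real.rpow_neg hTu.le, Real.rpow_neg hTu.le,
    Real.rpow_neg hl.le, Real.exp_neg]
  have := (Real.exp_pos (b * t ^ 2)).ne'
  have := (Real.rpow_pos_of_pos hu (b / a)).ne'
  have := (Real.rpow_pos_of_pos hTu (p * (b / a))).ne'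
  have := (Real.rpow_pos_of_pos hTu q).ne'
  have := (Real.rpow_pos_of_pos hl r).ne'
  have := hu.ne'
  field_simp

/-! ### Quantiles of atomless laws -/

theorem continuous_cdf (ν : Measure ℝ) [IsProbabilityMeasure ν] [NullSingletonClass ν] :
    Continuous (cdf ν) := by
  rw [continuous_iff_continuousAt]
  intro x
  rw [(monotone_cdf ν).continuousAt_iff_leftLim_eq_rightLim, StieltjesFunction.rightLim_eq]
  have h := (cdf ν).measure_singleton x
  rw [measure_cdf, measure_singleton, eq_comm, ENNReal.ofReal_eq_zero] at h
  exact le_antisymm ((monotone_cdf ν).leftLim_le le_rfl) (by linarith)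

/-- By continuity the superlevel set is closed, so its infimum belongs to it; to the left of the
infimum the cdf is below `u`, and continuity gives the other inequality. -/
theorem cdf_sInf_eq (ν : Measure ℝ) [IsProbabilityMeasure ν] [NullSingletonClass ν] {u : ℝ}
    (hu : u ∈ Set.Ioo (0 : ℝ) 1) : cdf ν (sInf {x | u ≤ cdf ν x}) = u := by
  have hc := continuous_cdf ν
  set S := {x | u ≤ cdf ν x} with hS
  have hne : S.Nonempty := by
    obtain ⟨x, hx⟩ := ((tendsto_cdf_atTop ν).eventually (lt_mem_nhds hu.2)).exists
    exact ⟨x, hx.le⟩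
  have hbdd : BddBelow S := by
    obtain ⟨x, hx⟩ := ((tendsto_cdf_atBot ν).eventually (gt_mem_nhds hu.1)).exists
    refine ⟨x, fun y hy => ?_⟩
    by_contra! hyx
    exact absurd (hy.trans (monotone_cdf ν hyx.le)) (not_le.2 hx)
  have hcl : IsClosed S := isClosed_le continuous_const hc
  refine le_antisymm ?_ (hcl.csInf_mem hne hbdd)
  refine le_of_tendsto (hc.continuousAt.mono_left (nhdsWithin_le_nhds (s := Set.Iio (sInf S)))) ?_
  filter_upwards [self_mem_nhdsWithin] with x hx
  by_contra! h
  exact absurd (csInf_le hbdd (show x ∈ S from h.le)) (not_le.2 hx)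

/-! ### Tails and quantiles of the skew normal vector -/

section Law

variable {Ω : Type*} [MeasurableSpace Ω] {P : Measure Ω}
  {X : Ω → Fin 2 → ℝ} {θ ρ : ℝ}

theorem map_coord_eq (hρ₁ : -1 < ρ) (hρ₂ : ρ < 1)
    (hX : HasLaw X (skewNormal₂ ![θ, θ] (corrMatrix ρ)) P) (i : Fin 2) :
    P.map (fun ω => X ω i) =
      volume.withDensity fun x => ENNReal.ofReal (skewNormalPDF (lam θ ρ) x) := by
  ext s hs
  have hm : AEMeasurable (fun ω => X ω i) P :=
    (measurable_pi_apply i).comp_aemeasurable hX.aemeasurable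
  rw [withDensity_apply _ hs, ← skewNormal₂_marginal hρ₁ hρ₂ θ i hs, ← hX.map_eq,
    Measure.map_apply_of_aemeasurable hm hs,
    Measure.map_apply_of_aemeasurable hX.aemeasurable
      (show MeasurableSet {x : Fin 2 → ℝ | x i ∈ s} from measurable_pi_apply i hs)]
  rfl

theorem real_orthant_eq_setIntegral (hρ₁ : -1 < ρ) (hρ₂ : ρ < 1)
    (hX : HasLaw X (skewNormal₂ ![θ, θ] (corrMatrix ρ)) P) (a : ℝ) :
    P.real {ω | X ω 0 ≤ a ∧ X ω 1 ≤ a} = (Real.pi * √(1 - ρ ^ 2))⁻¹ *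
      ∫ x in Set.Iic (fun _ : Fin 2 => a),
        Real.exp (-(x 0 ^ 2 - 2 * ρ * x 0 * x 1 + x 1 ^ 2) / (2 * (1 - ρ ^ 2))) *
          stdNormalCDF (θ * (x 0 + x 1)) := by
  have hset : {ω | X ω 0 ≤ a ∧ X ω 1 ≤ a} = X ⁻¹' Set.Iic (fun _ : Fin 2 => a) := by
    ext ω
    simp [Pi.le_def, Fin.forall_fin_two]
  rw [hset, Measure.real, ← Measure.map_apply_of_aemeasurable hX.aemeasurable measurableSet_Iic,
    hX.map_eq, skewNormal₂, withDensity_apply _ measurableSet_Iic,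
    ← integral_eq_lintegral_of_nonneg_ae _
      (measurable_skewNormalPDF₂ hρ₁ hρ₂ θ).aestronglyMeasurable, ← integral_const_mul]
  · simp_rw [skewNormalPDF₂_eq hρ₁ hρ₂]
  · refine Eventually.of_forall fun x => ?_
    rw [skewNormalPDF₂_eq hρ₁ hρ₂]
    have := stdNormalCDF_nonneg (θ * (x 0 + x 1))
    simp only [Pi.zero_apply]
    positivity

theorem nullSingletonClass_map_coord (hρ₁ : -1 < ρ) (hρ₂ : ρ < 1)
    (hX : HasLaw X (skewNormal₂ ![θ, θ] (corrMatrix ρ)) P) (i : Fin 2) :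
    NullSingletonClass (P.map fun ω => X ω i) := by
  rw [map_coord_eq hρ₁ hρ₂ hX]
  infer_instance

/-- The skewing factor is a function of the mean `s` of the coordinates, as `θ (x 0 + x 1) = 2 θ s`;
hence the slope `2 θ`. -/
theorem tendsto_real_orthant (hρ₁ : -1 < ρ) (hρ₂ : ρ < 1)
    (hX : HasLaw X (skewNormal₂ ![θ, θ] (corrMatrix ρ)) P) {m : ℝ → ℝ} {δ : ℝ} (hδ : 0 ≤ δ)
    (h : IsTailScale (fun s => stdNormalCDF (-(2 * θ * s))) m δ) :
    Tendsto (fun t => P.real {ω | X ω 0 ≤ -t ∧ X ω 1 ≤ -t} * t ^ 2 /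
      (Real.exp (-t ^ 2 / (1 + ρ)) * m t)) atTop
      (𝓝 ((Real.pi * √(1 - ρ ^ 2))⁻¹ * (1 / (1 / (1 + ρ) + δ / 2)) ^ 2)) := by
  have := measurable_stdNormalCDF
  refine ((gaussian_tail_two_dim hδ hρ₁ hρ₂ (by fun_prop) h).const_mul
    (Real.pi * √(1 - ρ ^ 2))⁻¹).congr fun t => ?_
  have e : ∀ x : Fin 2 → ℝ, -(2 * θ * -((x 0 + x 1) / 2)) = θ * (x 0 + x 1) := fun x => by ring
  simp only [real_orthant_eq_setIntegral hρ₁ hρ₂ hX, e]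
  ring

variable [IsProbabilityMeasure P]

theorem marginalCDF_eq_cdf (hX : AEMeasurable X P) (i : Fin 2) :
    marginalCDF P X i = cdf (P.map fun ω => X ω i) := by
  have hm : AEMeasurable (fun ω => X ω i) P := (measurable_pi_apply i).comp_aemeasurable hX
  have := Measure.isProbabilityMeasure_map hm
  ext x
  rw [cdf_eq_real, Measure.real, Measure.map_apply_of_aemeasurable hm measurableSet_Iic]
  rfl

theorem marginalCDF_eq_setIntegral (hρ₁ : -1 < ρ) (hρ₂ : ρ < 1)
    (hX : HasLaw X (skewNormal₂ ![θ, θ] (corrMatrix ρ)) P) (i : Fin 2) (x : ℝ) :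
    marginalCDF P X i x = 2 * (√(2 * Real.pi))⁻¹ *
      ∫ y in Set.Iic x, Real.exp (-y ^ 2 / 2) * stdNormalCDF (lam θ ρ * y) := by
  have hm : AEMeasurable (fun ω => X ω i) P :=
    (measurable_pi_apply i).comp_aemeasurable hX.aemeasurable
  have := Measure.isProbabilityMeasure_map hm
  rw [marginalCDF_eq_cdf hX.aemeasurable, cdf_eq_real, Measure.real, map_coord_eq hρ₁ hρ₂ hX,
    withDensity_apply _ measurableSet_Iic, ← integral_eq_lintegral_of_nonneg_ae
      (Eventually.of_forall fun y => skewNormalPDF_nonneg _ y)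
      (measurable_skewNormalPDF _).aestronglyMeasurable, ← integral_const_mul]
  congr 1
  ext y
  rw [skewNormalPDF, gaussianPDFReal_zero_one]
  ring

theorem marginalCDF_quantile (hρ₁ : -1 < ρ) (hρ₂ : ρ < 1)
    (hX : HasLaw X (skewNormal₂ ![θ, θ] (corrMatrix ρ)) P) (i : Fin 2) {u : ℝ}
    (hu : u ∈ Set.Ioo (0 : ℝ) 1) : marginalCDF P X i (quantile P X i u) = u := by
  have hm : AEMeasurable (fun ω => X ω i) P :=
    (measurable_pi_apply i).comp_aemeasurable hX.aemeasurable
  have := Measure.isProbabilityMeasure_map hm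
  have := nullSingletonClass_map_coord hρ₁ hρ₂ hX i
  rw [quantile, marginalCDF_eq_cdf hX.aemeasurable]
  exact cdf_sInf_eq _ hu

theorem quantile_one_eq_quantile_zero (hρ₁ : -1 < ρ) (hρ₂ : ρ < 1)
    (hX : HasLaw X (skewNormal₂ ![θ, θ] (corrMatrix ρ)) P) (u : ℝ) :
    quantile P X 1 u = quantile P X 0 u := by
  simp_rw [quantile, marginalCDF_eq_setIntegral hρ₁ hρ₂ hX]

theorem lowerTailDependence_eq_copula_div (hρ₁ : -1 < ρ) (hρ₂ : ρ < 1)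
    (hX : HasLaw X (skewNormal₂ ![θ, θ] (corrMatrix ρ)) P) {u : ℝ} (hu : u ∈ Set.Ioo (0 : ℝ) 1) :
    lowerTailDependence P X u = copula P X u u / u := by
  have hm : AEMeasurable (fun ω => X ω 1) P :=
    (measurable_pi_apply 1).comp_aemeasurable hX.aemeasurable
  have hn : NullMeasurableSet {ω | X ω 1 ≤ quantile P X 1 u} P :=
    hm.nullMeasurableSet_preimage measurableSet_Iic
  have h1 : P.real {ω | X ω 1 ≤ quantile P X 1 u} = u := marginalCDF_quantile hρ₁ hρ₂ hX 1 hu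
  rw [lowerTailDependence, ProbabilityTheory.cond, measureReal_ennreal_smul_apply, Measure.real,
    Measure.restrict_apply₀' hn, ENNReal.toReal_inv]
  rw [Measure.real] at h1
  rw [h1, copula, Measure.real, div_eq_inv_mul]
  rfl

/-- A quantile above `b` would force `u ≥ F(b) > 0`, which fails for small `u`. -/
theorem tendsto_quantile_atBot (hρ₁ : -1 < ρ) (hρ₂ : ρ < 1)
    (hX : HasLaw X (skewNormal₂ ![θ, θ] (corrMatrix ρ)) P) (i : Fin 2)
    (hpos : ∀ x, 0 < marginalCDF P X i x) :
    Tendsto (quantile P X i) (𝓝[>] 0) atBot := by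
  have hm : AEMeasurable (fun ω => X ω i) P :=
    (measurable_pi_apply i).comp_aemeasurable hX.aemeasurable
  have := Measure.isProbabilityMeasure_map hm
  have hmono : Monotone (marginalCDF P X i) := by
    rw [marginalCDF_eq_cdf hX.aemeasurable]; exact monotone_cdf _
  rw [tendsto_atBot]
  intro b
  filter_upwards [Ioo_mem_nhdsGT (hpos b), Ioo_mem_nhdsGT (zero_lt_one' ℝ)] with u hu hu1
  by_contra! h
  have h2 := hmono h.le
  rw [marginalCDF_quantile hρ₁ hρ₂ hX i hu1] at h2
  exact absurd h2 (not_le.2 hu.2)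

/-- The asymptotic expansion of `λ_L` from Gaussian-type tails of the marginal and of the joint
distribution function. -/
theorem lowerTailDependence_isEquivalent (hρ₁ : -1 < ρ) (hρ₂ : ρ < 1)
    (hX : HasLaw X (skewNormal₂ ![θ, θ] (corrMatrix ρ)) P) {c₁ c₂ a b p q : ℝ} (hc₁ : 0 < c₁)
    (hc₂ : 0 < c₂) (ha : 0 < a)
    (hU : Tendsto (fun t => marginalCDF P X 0 (-t) * t ^ p * Real.exp (a * t ^ 2)) atTop (𝓝 c₁))
    (hG : Tendsto (fun t => P.real {ω | X ω 0 ≤ -t ∧ X ω 1 ≤ -t} * t ^ q * Real.exp (b * t ^ 2))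
      atTop (𝓝 c₂)) :
    lowerTailDependence P X ~[𝓝[>] 0] fun u =>
      c₂ * c₁ ^ (-(b / a)) * a ^ (-((p * (b / a) - q) / 2)) * u ^ (b / a - 1) *
        (-Real.log u) ^ ((p * (b / a) - q) / 2) := by
  have hmono : Monotone (marginalCDF P X 0) := by
    rw [marginalCDF_eq_cdf hX.aemeasurable]; exact monotone_cdf _
  -- A positive limit in `hU` makes the cdf positive far to the left, hence everywhere by
  -- monotonicity.
  have hpos : ∀ x, 0 < marginalCDF P X 0 x := by
    intro x
    obtain ⟨t, ht, htx, ht0⟩ := ((hU.eventually (lt_mem_nhds hc₁)).and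
      ((eventually_ge_atTop (-x)).and (eventually_gt_atTop 0))).exists
    have h1 : 0 < marginalCDF P X 0 (-t) :=
      pos_of_mul_pos_left (pos_of_mul_pos_left ht (Real.exp_pos _).le) (by positivity)
    exact h1.trans_le (hmono (by linarith))
  have hT : Tendsto (fun u => -quantile P X 0 u) (𝓝[>] 0) atTop :=
    tendsto_neg_atBot_atTop.comp (tendsto_quantile_atBot hρ₁ hρ₂ hX 0 hpos)
  have h01 : ∀ᶠ u in 𝓝[>] (0 : ℝ), u ∈ Set.Ioo (0 : ℝ) 1 := Ioo_mem_nhdsGT zero_lt_one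
  refine (isEquivalent_of_gaussian_tails hc₁ hc₂ ha hU hG hT ?_).congr_left ?_
  · filter_upwards [h01] with u hu
    rw [neg_neg, marginalCDF_quantile hρ₁ hρ₂ hX 0 hu]
  · filter_upwards [h01] with u hu
    rw [lowerTailDependence_eq_copula_div hρ₁ hρ₂ hX hu, copula, neg_neg,
      quantile_one_eq_quantile_zero hρ₁ hρ₂ hX]

theorem tendsto_marginalCDF (hρ₁ : -1 < ρ) (hρ₂ : ρ < 1)
    (hX : HasLaw X (skewNormal₂ ![θ, θ] (corrMatrix ρ)) P) {m : ℝ → ℝ} {δ : ℝ} (hδ : 0 ≤ δ)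
    (h : IsTailScale (fun s => stdNormalCDF (-(lam θ ρ * s))) m δ) :
    Tendsto (fun t => marginalCDF P X 0 (-t) * t / (Real.exp (-t ^ 2 / 2) * m t)) atTop
      (𝓝 (2 * (√(2 * Real.pi))⁻¹ * (1 / (1 + δ)))) := by
  have := measurable_stdNormalCDF
  refine ((gaussian_tail_one_dim hδ (by fun_prop) h).const_mul
    (2 * (√(2 * Real.pi))⁻¹)).congr fun t => ?_
  simp only [marginalCDF_eq_setIntegral hρ₁ hρ₂ hX, mul_neg, neg_neg]
  ring

end Law

/-! ### Algebra of the constants -/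

section Constants

variable {θ ρ : ℝ}

theorem lam_pos (hρ₁ : -1 < ρ) (hρ₂ : ρ < 1) (hθ : 0 < θ) : 0 < lam θ ρ := by
  have h : 0 < 1 - ρ ^ 2 := by nlinarith
  have : 0 < 1 + ρ := by linarith
  unfold lam
  positivity

theorem lam_neg (hρ₁ : -1 < ρ) (hρ₂ : ρ < 1) (hθ : θ < 0) : lam θ ρ < 0 := by
  have h : 0 < 1 - ρ ^ 2 := by nlinarith
  have : 0 < 1 + ρ := by linarith
  exact div_neg_of_neg_of_pos (mul_neg_of_neg_of_pos hθ this) (by positivity)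

theorem beta_sq (hρ₁ : -1 < ρ) (hρ₂ : ρ < 1) :
    beta θ ρ ^ 2 = (1 - ρ) * (1 + 2 * θ ^ 2 * (1 + ρ)) / (1 + ρ) := by
  have h1 : 0 < 1 + ρ := by linarith
  have h2 : 0 < 1 - ρ := by linarith
  exact Real.sq_sqrt (by positivity)

theorem lam_sq (hρ₁ : -1 < ρ) (hρ₂ : ρ < 1) :
    lam θ ρ ^ 2 = θ ^ 2 * (1 + ρ) ^ 2 / (1 + θ ^ 2 * (1 - ρ ^ 2)) := by
  have h : 0 < 1 - ρ ^ 2 := by nlinarith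
  rw [lam, div_pow, Real.sq_sqrt (by positivity), mul_pow]

theorem rate_div_eq_one_add_beta_sq (hρ₁ : -1 < ρ) (hρ₂ : ρ < 1) :
    (1 / (1 + ρ) + 2 * θ ^ 2) / ((1 + lam θ ρ ^ 2) / 2) = 1 + beta θ ρ ^ 2 := by
  have h : 0 < 1 - ρ ^ 2 := by nlinarith
  have h1 : 0 < 1 + ρ := by linarith
  have h2 : 0 < 1 + θ ^ 2 * (1 - ρ ^ 2) := by positivity
  have h3 : 0 < 1 + lam θ ρ ^ 2 := by positivity
  rw [div_eq_iff (by positivity), lam_sq hρ₁ hρ₂, beta_sq hρ₁ hρ₂]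
  field_simp
  ring

/-- The left side is the constant `c₂` of the joint tail when `θ > 0`. -/
theorem prefactor_eq (hρ₁ : -1 < ρ) (hρ₂ : ρ < 1) (hθ : 0 < θ) :
    (Real.pi * √(1 - ρ ^ 2))⁻¹ * (1 / (1 / (1 + ρ) + 2 * θ ^ 2)) ^ 2 *
        (√(2 * Real.pi) * (2 * θ))⁻¹ =
      alpha θ ρ ^ 3 / (Real.pi * lam θ ρ ^ 4 * beta θ ρ * (1 + beta θ ρ ^ 2) ^ 2) *
        √(2 / Real.pi) := by
  have h : 0 < 1 - ρ ^ 2 := by nlinarith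
  have h1 : 0 < 1 + ρ := by linarith
  have h2 : 0 < 1 - ρ := by linarith
  set D := 1 + 2 * θ ^ 2 * (1 + ρ) with hD
  set E := 1 + θ ^ 2 * (1 - ρ ^ 2) with hE
  have hD0 : 0 < D := by positivity
  have hE0 : 0 < E := by positivity
  have hb : 1 + beta θ ρ ^ 2 = 2 * E / (1 + ρ) := by
    rw [beta_sq hρ₁ hρ₂, hE]; field_simp; ring
  have hκ : 1 / (1 + ρ) + 2 * θ ^ 2 = D / (1 + ρ) := by rw [hD]; field_simp
  have hl4 : lam θ ρ ^ 4 = θ ^ 4 * (1 + ρ) ^ 4 / E ^ 2 := by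
    rw [show lam θ ρ ^ 4 = (lam θ ρ ^ 2) ^ 2 by ring, lam_sq hρ₁ hρ₂, div_pow]; ring
  have ha : alpha θ ρ = θ * (1 + ρ) / √D := rfl
  have hβ : beta θ ρ = √(1 - ρ) * √D / √(1 + ρ) := by
    rw [beta, Real.sqrt_div (by positivity), Real.sqrt_mul h2.le]
  have hρs : √(1 - ρ ^ 2) = √(1 - ρ) * √(1 + ρ) := by
    rw [← Real.sqrt_mul h2.le]; congr 1; ring
  rw [hb, hκ, hl4, ha, hβ, hρs, Real.sqrt_mul zero_le_two, Real.sqrt_div zero_le_two]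
  have s1 : √(1 + ρ) ^ 2 = 1 + ρ := Real.sq_sqrt h1.le
  have sD : √D ^ 2 = D := Real.sq_sqrt hD0.le
  have s2 : √(2 : ℝ) ^ 2 = 2 := Real.sq_sqrt zero_le_two
  have p1 : 0 < √(1 + ρ) := by positivity
  have p2 : 0 < √(1 - ρ) := by positivity
  have p3 : 0 < √D := by positivity
  have p4 : 0 < √Real.pi := Real.sqrt_pos.2 Real.pi_pos
  have p5 : 0 < √(2 : ℝ) := by positivity
  have hpi := Real.pi_pos
  generalize √(1 + ρ) = x at *
  generalize √(1 - ρ) = y at *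
  generalize √D = z at *
  generalize √Real.pi = w at *
  generalize √(2 : ℝ) = v at *
  rw [← sD, ← s1]
  field_simp
  rw [s2]

end Constants

/-! ### The two signs of the skewness -/

section Asymptotics

variable {Ω : Type*} [MeasurableSpace Ω] {P : Measure Ω} [IsProbabilityMeasure P]
  {X : Ω → Fin 2 → ℝ} {θ ρ : ℝ}

theorem lowerTailDependence_isEquivalent_of_pos (hρ₁ : -1 < ρ) (hρ₂ : ρ < 1)
    (hX : HasLaw X (skewNormal₂ ![θ, θ] (corrMatrix ρ)) P) (hθ : 0 < θ) :
    lowerTailDependence P X ~[𝓝[>] 0] fun u : ℝ =>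
      u ^ (beta θ ρ ^ 2) *
        (alpha θ ρ ^ 3 / (Real.pi * lam θ ρ ^ 4 * beta θ ρ * (1 + beta θ ρ ^ 2) ^ 2)) *
        √(2 / Real.pi) * (2 * Real.pi * lam θ ρ) ^ (1 + beta θ ρ ^ 2) *
        ((1 + lam θ ρ ^ 2) / 2) ^ (3 / 2 : ℝ) * (-Real.log u) ^ (beta θ ρ ^ 2 - 1 / 2) := by
  have hρ : 0 < 1 - ρ ^ 2 := by nlinarith
  have h1 : 0 < 1 + ρ := by linarith
  have hl := lam_pos hρ₁ hρ₂ hθ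
  have hpi := Real.pi_pos
  have hU := tendsto_marginalCDF hρ₁ hρ₂ hX (sq_nonneg _) (isTailScale_stdNormalCDF_of_pos hl)
  have hG := tendsto_real_orthant hρ₁ hρ₂ hX (sq_nonneg _)
    (isTailScale_stdNormalCDF_of_pos (by positivity : 0 < 2 * θ))
  rw [show (2 * θ) ^ 2 / 2 = 2 * θ ^ 2 by ring] at hG
  have hs : (√(2 * Real.pi))⁻¹ * (√(2 * Real.pi))⁻¹ = (2 * Real.pi)⁻¹ := by
    rw [← mul_inv, Real.mul_self_sqrt (by positivity)]
  -- The Laplace limits give one power of `t` for the marginal and two for the orthant; the Mills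
  -- tail adds one to each.
  have hmain := lowerTailDependence_isEquivalent hρ₁ hρ₂ hX
    (c₁ := (Real.pi * lam θ ρ * (1 + lam θ ρ ^ 2))⁻¹)
    (c₂ := (Real.pi * √(1 - ρ ^ 2))⁻¹ * (1 / (1 / (1 + ρ) + 2 * θ ^ 2)) ^ 2 *
        (√(2 * Real.pi) * (2 * θ))⁻¹)
    (a := (1 + lam θ ρ ^ 2) / 2) (b := 1 / (1 + ρ) + 2 * θ ^ 2) (p := 2) (q := 3)
    (by positivity) (by positivity) (by positivity) ?_ ?_
  · rw [rate_div_eq_one_add_beta_sq hρ₁ hρ₂, prefactor_eq hρ₁ hρ₂ hθ] at hmain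
    refine hmain.congr_right (Eventually.of_forall fun u => ?_)
    set B := beta θ ρ ^ 2
    have ha : 0 < (1 + lam θ ρ ^ 2) / 2 := by positivity
    have e1 : (Real.pi * lam θ ρ * (1 + lam θ ρ ^ 2))⁻¹ ^ (-(1 + B)) =
        (2 * Real.pi * lam θ ρ) ^ (1 + B) * ((1 + lam θ ρ ^ 2) / 2) ^ (1 + B) := by
      rw [Real.rpow_neg (by positivity), Real.inv_rpow (by positivity), inv_inv,
        ← Real.mul_rpow (by positivity) (by positivity)]
      congr 1
      ring
    -- The power `1 + B` comes from `c₁` and the other from `a`; the exponents add up to `3 / 2`.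
    have e2 : ((1 + lam θ ρ ^ 2) / 2) ^ (3 / 2 : ℝ) = ((1 + lam θ ρ ^ 2) / 2) ^ (1 + B) *
        ((1 + lam θ ρ ^ 2) / 2) ^ (-((2 * (1 + B) - 3) / 2)) := by
      rw [← Real.rpow_add ha]
      congr 1
      ring
    have e3 : 1 + B - 1 = B := by ring
    have e4 : (2 * (1 + B) - 3) / 2 = B - 1 / 2 := by ring
    simp only [e1, e2, e3, e4]
    ring
  · have := hU.mul_const (√(2 * Real.pi) * lam θ ρ)⁻¹
    have e : 2 * (√(2 * Real.pi))⁻¹ * (1 / (1 + lam θ ρ ^ 2)) * (√(2 * Real.pi) * lam θ ρ)⁻¹ =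
        (Real.pi * lam θ ρ * (1 + lam θ ρ ^ 2))⁻¹ := by
      calc _ = 2 * ((√(2 * Real.pi))⁻¹ * (√(2 * Real.pi))⁻¹) * (1 / (1 + lam θ ρ ^ 2)) *
            (lam θ ρ)⁻¹ := by rw [mul_inv]; ring
        _ = _ := by rw [hs]; field_simp
    rw [e] at this
    refine this.congr' ((eventually_gt_atTop 0).mono fun t ht => ?_)
    have e2 : Real.exp ((1 + lam θ ρ ^ 2) / 2 * t ^ 2) =
        (Real.exp (-t ^ 2 / 2) * Real.exp (-(lam θ ρ * t) ^ 2 / 2))⁻¹ := by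
      rw [← Real.exp_add, ← Real.exp_neg]; congr 1; ring
    have e3 : t ^ (2 : ℝ) = t ^ 2 := by norm_cast
    have := Real.exp_pos (-t ^ 2 / 2)
    have := Real.exp_pos (-(lam θ ρ * t) ^ 2 / 2)
    have hs0 : 0 < √(2 * Real.pi) := by positivity
    simp only [e2, e3]
    field_simp
  · have := hG.mul_const (√(2 * Real.pi) * (2 * θ))⁻¹
    refine this.congr' ((eventually_gt_atTop 0).mono fun t ht => ?_)
    have e2 : Real.exp ((1 / (1 + ρ) + 2 * θ ^ 2) * t ^ 2) =
        (Real.exp (-t ^ 2 / (1 + ρ)) * Real.exp (-(2 * θ * t) ^ 2 / 2))⁻¹ := by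
      rw [← Real.exp_add, ← Real.exp_neg]; congr 1; ring
    have e3 : t ^ (3 : ℝ) = t ^ 3 := by norm_cast
    have := Real.exp_pos (-t ^ 2 / (1 + ρ))
    have := Real.exp_pos (-(2 * θ * t) ^ 2 / 2)
    have hs0 : 0 < √(2 * Real.pi) := by positivity
    simp only [e2, e3]
    field_simp

theorem lowerTailDependence_isEquivalent_of_neg (hρ₁ : -1 < ρ) (hρ₂ : ρ < 1)
    (hX : HasLaw X (skewNormal₂ ![θ, θ] (corrMatrix ρ)) P) (hθ : θ < 0) :
    lowerTailDependence P X ~[𝓝[>] 0] fun u : ℝ =>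
      u ^ ((1 - ρ) / (1 + ρ)) * ((1 + ρ) / 2) * √((1 + ρ) / (1 - ρ)) *
        (-Real.pi * Real.log u) ^ (-ρ / (1 + ρ)) := by
  have hρ : 0 < 1 - ρ ^ 2 := by nlinarith
  have h1 : 0 < 1 + ρ := by linarith
  have h2 : 0 < 1 - ρ := by linarith
  have hpi := Real.pi_pos
  have hU := tendsto_marginalCDF hρ₁ hρ₂ hX le_rfl
    (isTailScale_stdNormalCDF_of_neg (lam_neg hρ₁ hρ₂ hθ))
  have hG := tendsto_real_orthant hρ₁ hρ₂ hX le_rfl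
    (isTailScale_stdNormalCDF_of_neg (by linarith : 2 * θ < 0))
  simp only [add_zero, div_one, mul_one, zero_div, one_div_one_div] at hU hG
  -- Here `Φ` tends to `1`, so no Mills factor alters the powers or the rates.
  have hmain := lowerTailDependence_isEquivalent hρ₁ hρ₂ hX (c₁ := 2 * (√(2 * Real.pi))⁻¹)
    (c₂ := (Real.pi * √(1 - ρ ^ 2))⁻¹ * (1 + ρ) ^ 2)
    (a := 1 / 2) (b := 1 / (1 + ρ)) (p := 1) (q := 2)
    (by positivity) (by positivity) (by positivity) ?_ ?_
  · refine hmain.congr_right ?_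
    filter_upwards [Ioo_mem_nhdsGT (zero_lt_one' ℝ)] with u hu
    have hlog : 0 < -Real.log u := by have := Real.log_neg hu.1 hu.2; linarith
    -- `r` is the exponent of the logarithm; the ratio of rates is `2 / (1 + ρ) = 2 (1 + r)`.
    set r := -ρ / (1 + ρ) with hr
    have e1 : 1 / (1 + ρ) / (1 / 2) = 2 * (1 + r) := by rw [hr]; field_simp; ring
    have e2 : (1 * (2 * (1 + r)) - 2) / 2 = r := by ring
    have e3 : 2 * (1 + r) - 1 = (1 - ρ) / (1 + ρ) := by rw [hr]; field_simp; ring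
    have e4 : (2 * (√(2 * Real.pi))⁻¹) ^ (-(2 * (1 + r))) = Real.pi / 2 * (Real.pi / 2) ^ r := by
      have hb : (2 * (√(2 * Real.pi))⁻¹) ^ (2 : ℝ) = (Real.pi / 2)⁻¹ := by
        rw [Real.rpow_two, mul_pow, inv_pow, Real.sq_sqrt (by positivity)]
        field_simp
      rw [show -(2 * (1 + r)) = 2 * (-(1 + r)) by ring, Real.rpow_mul (by positivity), hb,
        Real.rpow_neg (by positivity), Real.inv_rpow (by positivity), inv_inv,
        Real.rpow_add (by positivity), Real.rpow_one]
    have e5 : (1 / 2 : ℝ) ^ (-r) = 2 ^ r := by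
      rw [one_div, Real.rpow_neg (by positivity), Real.inv_rpow (by positivity), inv_inv]
    have e6 : (Real.pi / 2) ^ r * 2 ^ r * (-Real.log u) ^ r = (-Real.pi * Real.log u) ^ r := by
      rw [← Real.mul_rpow (by positivity) (by positivity), ← Real.mul_rpow (by positivity) hlog.le]
      congr 1
      ring
    have e7 : √(1 - ρ ^ 2) = √(1 - ρ) * √(1 + ρ) := by
      rw [← Real.sqrt_mul h2.le]; congr 1; ring
    have e8 : (Real.pi * √(1 - ρ ^ 2))⁻¹ * (1 + ρ) ^ 2 * (Real.pi / 2) =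
        (1 + ρ) / 2 * √((1 + ρ) / (1 - ρ)) := by
      rw [e7, Real.sqrt_div h1.le]
      have s1 : √(1 + ρ) ^ 2 = 1 + ρ := Real.sq_sqrt h1.le
      have p1 : 0 < √(1 + ρ) := by positivity
      have p2 : 0 < √(1 - ρ) := by positivity
      field_simp
      rw [s1]
    simp only [e1, e2, e3, e4, e5]
    rw [← e6]
    linear_combination (u ^ ((1 - ρ) / (1 + ρ)) * (Real.pi / 2) ^ r * 2 ^ r *
      (-Real.log u) ^ r) * e8
  · refine hU.congr fun t => ?_
    rw [Real.rpow_one, show (1 / 2 : ℝ) * t ^ 2 = -(-t ^ 2 / 2) by ring, Real.exp_neg,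
      div_eq_mul_inv]
  · refine hG.congr fun t => ?_
    rw [Real.rpow_two, show 1 / (1 + ρ) * t ^ 2 = -(-t ^ 2 / (1 + ρ)) by ring, Real.exp_neg,
      div_eq_mul_inv]

end Asymptotics

end SkewNormal

theorem theorem2 {Ω : Type*} [MeasurableSpace Ω] (P : Measure Ω) [IsProbabilityMeasure P]
    (X : Ω → Fin 2 → ℝ) (θ ρ : ℝ) (hρ₁ : -1 < ρ) (hρ₂ : ρ < 1)
    (hX : HasLaw X (SkewNormal.skewNormal₂ ![θ, θ] (SkewNormal.corrMatrix ρ)) P) :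
    (∀ u ∈ Set.Ioo (0 : ℝ) 1,
      SkewNormal.lowerTailDependence P X u = SkewNormal.copula P X u u / u) ∧
    (0 < θ →
      SkewNormal.lowerTailDependence P X ~[𝓝[>] 0] fun u : ℝ =>
        u ^ (SkewNormal.beta θ ρ ^ 2) *
          (SkewNormal.alpha θ ρ ^ 3 /
            (Real.pi * SkewNormal.lam θ ρ ^ 4 * SkewNormal.beta θ ρ *
              (1 + SkewNormal.beta θ ρ ^ 2) ^ 2)) *
          √(2 / Real.pi) *
          (2 * Real.pi * SkewNormal.lam θ ρ) ^ (1 + SkewNormal.beta θ ρ ^ 2) *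
          ((1 + SkewNormal.lam θ ρ ^ 2) / 2) ^ (3 / 2 : ℝ) *
          (-Real.log u) ^ (SkewNormal.beta θ ρ ^ 2 - 1 / 2)) ∧
    (θ < 0 →
      SkewNormal.lowerTailDependence P X ~[𝓝[>] 0] fun u : ℝ =>
        u ^ ((1 - ρ) / (1 + ρ)) * ((1 + ρ) / 2) * √((1 + ρ) / (1 - ρ)) *
          (-Real.pi * Real.log u) ^ (-ρ / (1 + ρ))) := by
  refine ⟨fun u hu => SkewNormal.lowerTailDependence_eq_copula_div hρ₁ hρ₂ hX hu, ?_, ?_⟩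
  · exact SkewNormal.lowerTailDependence_isEquivalent_of_pos hρ₁ hρ₂ hX
  · exact SkewNormal.lowerTailDependence_isEquivalent_of_neg hρ₁ hρ₂ hX
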